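/- Let $N\ge 1$ and consider a discrete-time system of $N$ queues with $Q_n(t+1)=Q_n(t)+A_n(t)-S_n(t)+U_n(t)$, $U_n(t)=\max(S_n(t)-A_n(t)-Q_n(t),0)$. The arrival vectors $\mathbf A(t)\in\mathbb Z_{\ge 0}^N$ are i.i.d. over time, with independent coordinates satisfying $A_n(t)\le A_{\max}$, and $\mathbf A(t)$ is independent of $\mathbf Q(t)$ and $\mathbf S(t)$. The service vector is chosen by MaxWeight: given $\mathbf Q(t)$, $\mathbf S(t)$ is drawn at random among the maximizers of $\langle \mathbf Q(t),\mathbf s\rangle$ over $\mathbf s\in\mathcal S$, where $\mathcal S\subset\mathbb Z_{\ge 0}^N$ is the set of feasible service vectors, all with coordinates at most $S_{\max}$; the (possibly random) tie-breaking rule depends only on $\mathbf Q(t)$. Let the capacity region $\mathcal R=\mathrm{conv}(\mathcal S)$ have non-empty interior and be determined by hyperplanes with unit normals, $\mathcal R=\{\mathbf r\ge 0:\langle \mathbf c^{(j)},\mathbf r\rangle\le b^{(j)},\ j=1,\dots,K\}$, where $\|\mathbf c^{(j)}\|=1$ and none of the $K$ inequalities can be omitted. Fix $k$ such that $\mathbf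 c^{(k)}\ge 0$ coordinatewise, let $\mathcal F^{(k)}=\{\mathbf r\in\mathcal R:\langle\mathbf c^{(k)},\mathbf r\rangle=b^{(k)}\}$, and let $\boldsymbol\lambda^{(k)}$ be in the relative interior of $\mathcal F^{(k)}$. Then there is a constant $\delta^{(k)}>0$, determined by $\mathcal F^{(k)}$ and $\boldsymbol\lambda^{(k)}$ only, and there are finite constants $M^{(k)}_r$, $r=1,2,\dots$, independent of $\epsilon$, such that for every $\epsilon>0$, every such arrival process with mean vector $\boldsymbol\lambda^{(k)}-\epsilon\mathbf c^{(k)}$, and every random vector $\overline{\mathbf Q}$ distributed according to a steady-state (stationary) distribution of the queue length chain $\mathbf Q(t)$, $$\mathbb E\big[\|\overline{\mathbf Q}_\perp\|^r\big]\le M^{(k)}_r\qquad (r=1,2,\dots),$$ where $\overline{\mathbf Q}_\perp$ is $\overline{\mathbf Q}$ minus its orthogonal projection onto the line spanned by $\mathbf c^{(k)}$ and $\|\cdot\|$ is the Euclidean norm. Moreover $$M^{(k)}_r\le V^{(k)}_r\, r^{r+\frac12}e^{1-r},\qquad V^{(k)}_r=\left(\frac{4L}{\delta^{(k)}}+\frac{8D^2+4D\delta^{(k)}}{\delta^{(k)}}\right)^r,$$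 with $L=N\max(A_{\max},S_{\max})^2$ and $D=\sqrt N\max(A_{\max},S_{\max})$. -/

import Mathlib

open MeasureTheory ProbabilityTheory

namespace MaxWeightSSC

/-- Euclidean space `ℝ^N`, one coordinate per queue. -/
abbrev Vec (N : ℕ) : Type := EuclideanSpace ℝ (Fin N)

/-- A non-negative integer vector (queue lengths, arrivals, service rates) seen in `ℝ^N`. -/
noncomputable def toVec {N : ℕ} (q : Fin N → ℕ) : Vec N :=
  WithLp.toLp 2 (fun n => (q n : ℝ))

/-- The capacity region: the convex hull of the feasible service rate vectors. -/
def capacityRegion {N : ℕ} (𝒮 : Set (Fin N → ℕ)) : Set (Vec N) :=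
  convexHull ℝ (toVec '' 𝒮)

/-- The hyperplanes `⟨c j, r⟩ = b j`, `j = 1, …, K`, with unit normal vectors, determine the
capacity region: it equals `{r ≥ 0 : ⟨c j, r⟩ ≤ b j for all j}`, and none of the `K` inequalities
can be left out. -/
structure IsHyperplaneDescription {N K : ℕ} (𝒮 : Set (Fin N → ℕ)) (c : Fin K → Vec N)
    (b : Fin K → ℝ) : Prop where
  region_eq : capacityRegion 𝒮 = {r | (∀ n, 0 ≤ r n) ∧ ∀ j, inner ℝ (c j) r ≤ b j}
  unit : ∀ j, ‖c j‖ = 1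
  irredundant : ∀ j, ∃ r : Vec N,
    (∀ n, 0 ≤ r n) ∧ (∀ i, i ≠ j → inner ℝ (c i) r ≤ b i) ∧ b j < inner ℝ (c j) r

/-- The face cut out of the capacity region by the hyperplane `⟨c, r⟩ = b`. -/
def face {N : ℕ} (𝒮 : Set (Fin N → ℕ)) (c : Vec N) (b : ℝ) : Set (Vec N) :=
  {r | r ∈ capacityRegion 𝒮 ∧ inner ℝ c r = b}

/-- Unused service `U_n = max (S_n - A_n - Q_n, 0)` (the subtraction of `ℕ` truncates at `0`). -/
def unusedService {N : ℕ} (q a s : Fin N → ℕ) : Fin N → ℕ :=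
  fun n => s n - a n - q n

/-- Queue dynamics `Q_n(t+1) = Q_n(t) + A_n(t) - S_n(t) + U_n(t)`. -/
def nextQueue {N : ℕ} (q a s : Fin N → ℕ) : Fin N → ℕ :=
  fun n => q n + a n + unusedService q a s n - s n

/-- The natural number subtractions in the dynamics are the intended ones. -/
theorem nextQueue_cast {N : ℕ} (q a s : Fin N → ℕ) (n : Fin N) :
    (nextQueue q a s n : ℤ)
      = (q n : ℤ) + a n - s n + max ((s n : ℤ) - a n - q n) 0 := by
  simp only [nextQueue, unusedService]
  omega

/-- The law `α` of the vector of arrivals in one time slot: arrivals to different queues are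
independent, bounded by `Amax`, and have mean vector `lam`. -/
structure IsArrivalLaw {N : ℕ} (α : PMF (Fin N → ℕ)) (Amax : ℝ) (lam : Vec N) : Prop where
  indep : iIndepFun (fun (n : Fin N) (a : Fin N → ℕ) => a n) α.toMeasure
  bounded : ∀ a ∈ α.support, ∀ n, (a n : ℝ) ≤ Amax
  mean : ∀ n, ∫ a, (a n : ℝ) ∂α.toMeasure = lam n

/-- A scheduling policy `σ` (the law of the service vector given the queue lengths) is MaxWeight
if it picks the service vector at random among the maximisers of `⟨q, s⟩` over `s ∈ 𝒮`.
Any randomised tie-breaking rule, such as the uniform one, is allowed. -/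
def IsMaxWeight {N : ℕ} (𝒮 : Set (Fin N → ℕ)) (σ : (Fin N → ℕ) → PMF (Fin N → ℕ)) : Prop :=
  ∀ q, ∀ s ∈ (σ q).support,
    s ∈ 𝒮 ∧ ∀ s' ∈ 𝒮, inner ℝ (toVec q) (toVec s') ≤ inner ℝ (toVec q) (toVec s)

/-- One-step transition law of the queue length chain: given the queue lengths `q`, the arrivals
(law `α`) and the service vector (law `σ q`) are independent. -/
noncomputable def transition {N : ℕ} (α : PMF (Fin N → ℕ)) (σ : (Fin N → ℕ) → PMF (Fin N → ℕ))
    (q : Fin N → ℕ) : PMF (Fin N → ℕ) :=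
  α.bind fun a => (σ q).bind fun s => PMF.pure (nextQueue q a s)

/-- `π` is a steady-state (stationary) distribution of the queue length chain. -/
def IsSteadyState {N : ℕ} (α : PMF (Fin N → ℕ)) (σ : (Fin N → ℕ) → PMF (Fin N → ℕ))
    (π : PMF (Fin N → ℕ)) : Prop :=
  π.bind (transition α σ) = π

/-- `Q_⊥`: the queue length vector minus its orthogonal projection onto the line spanned by `c`. -/
noncomputable def perp {N : ℕ} (c : Vec N) (q : Fin N → ℕ) : Vec N :=
  toVec q - (Submodule.span ℝ {c}).starProjection (toVec q)

/-- `L = N max(Amax, Smax)^2`. -/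
noncomputable def constL (N : ℕ) (Amax Smax : ℝ) : ℝ := N * max Amax Smax ^ 2

/-- `D = √N max(Amax, Smax)`. -/
noncomputable def constD (N : ℕ) (Amax Smax : ℝ) : ℝ := Real.sqrt N * max Amax Smax

/-- `V_r = (4L/δ + (8D² + 4Dδ)/δ)^r`. -/
noncomputable def constV (N : ℕ) (Amax Smax δ : ℝ) (r : ℕ) : ℝ :=
  (4 * constL N Amax Smax / δ
    + (8 * constD N Amax Smax ^ 2 + 4 * constD N Amax Smax * δ) / δ) ^ r

end MaxWeightSSC

namespace MaxWeightSSC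

open scoped ENNReal

/-! The Lyapunov function is `cosh (θ * ‖Q_⊥‖)`. The increment of `‖Q_⊥‖ ^ 2` has a bound linear in
`A - S`, and `sinh (θ * z) / z ≤ θ * cosh (θ * z)` carries this over to `cosh` even near `z = 0`
(`cosh_step`).

Drift: an irredundant inequality of a full-dimensional region cuts out a facet, so `lam` is the
centre of a ball of the hyperplane, of radius `ρ`, inside the face. MaxWeight does at least as well
as the point of this ball farthest in the direction `Q_⊥`, so the service exceeds `lam` by at least
`ρ * ‖Q_⊥‖` in that direction. The mean arrival differs from `lam` by a multiple of `c`, orthogonal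
to `Q_⊥`; hence `ε` drops out.

In steady state this gives `E cosh ≤ 2` (`expect_cosh_drift`, `expect_le_of_drift`). Comparing
powers with `cosh` yields moments at most `(4 / θ) ^ r * r!`, and a Stirling bound on `r!` finishes.
-/

/-! ### Discrete expectations and the stationary drift bound -/

/-- The expectation of a non-negative extended function under a discrete law. -/
noncomputable def expect {X : Type*} (p : PMF X) (f : X → ℝ≥0∞) : ℝ≥0∞ := ∑' x, p x * f x

theorem expect_mono {X : Type*} {p : PMF X} {f g : X → ℝ≥0∞}
    (h : ∀ x ∈ p.support, f x ≤ g x) : expect p f ≤ expect p g := by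
  refine ENNReal.tsum_le_tsum fun x => ?_
  by_cases hx : p x = 0
  · simp [hx]
  · exact mul_le_mul_right (h x hx) _

theorem expect_add {X : Type*} (p : PMF X) (f g : X → ℝ≥0∞) :
    expect p (fun x => f x + g x) = expect p f + expect p g := by
  simp only [expect, mul_add, ENNReal.tsum_add]

theorem expect_const_mul {X : Type*} (p : PMF X) (a : ℝ≥0∞) (f : X → ℝ≥0∞) :
    expect p (fun x => a * f x) = a * expect p f := by
  simp only [expect, ← ENNReal.tsum_mul_left]
  exact tsum_congr fun x => by ring

theorem expect_const {X : Type*} (p : PMF X) (a : ℝ≥0∞) : expect p (fun _ => a) = a := by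
  simp [expect, ENNReal.tsum_mul_right, p.tsum_coe]

theorem expect_bind {X Y : Type*} (p : PMF X) (P : X → PMF Y) (f : Y → ℝ≥0∞) :
    expect (p.bind P) f = expect p fun x => expect (P x) f := by
  simp only [expect, PMF.bind_apply, ← ENNReal.tsum_mul_right, ← ENNReal.tsum_mul_left]
  rw [ENNReal.tsum_comm]
  exact tsum_congr fun x => tsum_congr fun y => by ring

theorem expect_pure {X : Type*} (x : X) (f : X → ℝ≥0∞) : expect (PMF.pure x) f = f x := by
  rw [expect, tsum_eq_single x]
  · simp
  · intro y hy
    simp [PMF.pure_apply, hy]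

theorem lintegral_toMeasure {X : Type*} [Countable X] [MeasurableSpace X]
    [MeasurableSingletonClass X] (p : PMF X) (f : X → ℝ≥0∞) :
    ∫⁻ x, f x ∂p.toMeasure = expect p f := by
  rw [lintegral_countable', expect]
  refine tsum_congr fun x => ?_
  rw [PMF.toMeasure_apply_singleton _ _ (measurableSet_singleton x), mul_comm]

theorem ae_toMeasure_iff {X : Type*} [Countable X] [MeasurableSpace X]
    [MeasurableSingletonClass X] {p : PMF X} {Q : X → Prop} (h : ∀ x ∈ p.support, Q x) :
    ∀ᵐ x ∂p.toMeasure, Q x := by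
  rw [ae_iff, PMF.toMeasure_apply_eq_zero_iff _ (Set.to_countable _).measurableSet,
    Set.disjoint_left]
  exact fun x hx hq => hq (h x hx)

/-- A Foster–Lyapunov bound for a stationary law: no integrability of the Lyapunov function is
assumed. -/
theorem expect_le_of_drift {X : Type*} {P : X → PMF X} {π : PMF X} (hπ : π.bind P = π)
    {V f g : X → ℝ≥0∞} (hV : ∀ x, V x ≠ ∞)
    (hd : ∀ x, expect (P x) V + f x ≤ V x + g x) : expect π f ≤ expect π g := by
  classical
  rw [expect, ENNReal.tsum_eq_iSup_sum]
  refine iSup_le fun s => ?_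
  -- Truncating `V` at its maximum over the finite set `s` makes its stationary mean finite, hence
  -- cancellable. The drift survives: where `V` exceeds `B`, the truncation is already maximal and
  -- `f'` vanishes.
  set B : ℝ≥0∞ := s.sup V with hB
  have hBtop : B ≠ ∞ := by
    refine ne_of_lt ((Finset.sup_lt_iff (by simp)).2 fun x _ => (hV x).lt_top)
  set W : X → ℝ≥0∞ := fun x => min (V x) B with hW
  set f' : X → ℝ≥0∞ := fun x => if V x ≤ B then f x else 0 with hf'
  have hm : expect π W ≠ ∞ := by
    refine ne_top_of_le_ne_top hBtop ?_
    calc expect π W ≤ expect π fun _ => B := expect_mono fun x _ => min_le_right _ _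
      _ = B := expect_const π B
  have key : expect π W + expect π f' ≤ expect π W + expect π g := by
    calc expect π W + expect π f'
        = expect π (fun x => expect (P x) W + f' x) := by
          rw [expect_add, ← expect_bind, hπ]
      _ ≤ expect π (fun x => W x + g x) := by
          refine expect_mono fun x _ => ?_
          by_cases hx : V x ≤ B
          · simp only [hf', hW, if_pos hx, min_eq_left hx]
            refine le_trans (add_le_add_left (expect_mono fun y _ => min_le_left _ _) _) (hd x)
          · simp only [hf', hW, if_neg hx, min_eq_right (not_le.1 hx).le, add_zero]
            refine le_trans ?_ le_self_add
            calc expect (P x) (fun y => min (V y) B) ≤ expect (P x) fun _ => B :=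
                  expect_mono fun y _ => min_le_right _ _
              _ = B := expect_const _ B
      _ = _ := expect_add _ _ _
  refine le_trans ?_ ((ENNReal.add_le_add_iff_left hm).1 key)
  calc ∑ x ∈ s, π x * f x = ∑ x ∈ s, π x * f' x := by
        refine Finset.sum_congr rfl fun x hx => ?_
        simp only [hf', if_pos (show V x ≤ B from Finset.le_sup hx)]
    _ ≤ expect π f' := ENNReal.sum_le_tsum s

/-! ### Hyperbolic and factorial estimates -/

theorem cosh_le_one_add_sq {x : ℝ} (hx : |x| ≤ 1) : Real.cosh x ≤ 1 + x ^ 2 := by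
  have h1 := (abs_le.1 (Real.abs_exp_sub_one_sub_id_le hx)).2
  have h2 := (abs_le.1 (Real.abs_exp_sub_one_sub_id_le (x := -x) (by rwa [abs_neg]))).2
  rw [Real.cosh_eq]
  nlinarith

theorem sinh_le_add_sq {x : ℝ} (hx : |x| ≤ 1) : Real.sinh x ≤ x + x ^ 2 := by
  have h1 := (abs_le.1 (Real.abs_exp_sub_one_sub_id_le hx)).2
  have h2 := (abs_le.1 (Real.abs_exp_sub_one_sub_id_le (x := -x) (by rwa [abs_neg]))).1
  rw [Real.sinh_eq]
  nlinarith

theorem sinh_le_mul_cosh {x : ℝ} (hx : 0 ≤ x) : Real.sinh x ≤ x * Real.cosh x := by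
  have hmono : MonotoneOn (fun y => y * Real.cosh y - Real.sinh y) (Set.Ici 0) := by
    refine monotoneOn_of_deriv_nonneg (convex_Ici 0) (by fun_prop) (by fun_prop) fun y hy => ?_
    have hy' : 0 < y := by simpa using hy
    have h : HasDerivAt (fun y => y * Real.cosh y - Real.sinh y)
        (1 * Real.cosh y + y * Real.sinh y - Real.cosh y) y :=
      ((hasDerivAt_id y).mul (Real.hasDerivAt_cosh y)).sub (Real.hasDerivAt_sinh y)
    rw [h.deriv]
    have := mul_nonneg hy'.le (Real.sinh_nonneg_iff.2 hy'.le)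
    linarith
  have := hmono (Set.mem_Ici.2 le_rfl) (Set.mem_Ici.2 hx) hx
  simp only [zero_mul, Real.sinh_zero, sub_zero] at this
  linarith

/-- One-step bound for `cosh (θ z)` when `z` moves by at most `D` and the increment of `z ^ 2` is
at most `2 * m + D ^ 2`. -/
theorem cosh_step {θ D z z' m : ℝ} (hθ : 0 ≤ θ) (hθD : θ * D ≤ 1) (hz : 0 ≤ z)
    (hd : |z' - z| ≤ D) (hsq : z' ^ 2 ≤ z ^ 2 + 2 * m + D ^ 2) :
    Real.cosh (θ * z') ≤ Real.cosh (θ * z) * (1 + 5 / 2 * (θ * D) ^ 2)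
      + θ * (Real.sinh (θ * z) / z) * m := by
  set d := z' - z with hdd
  have hz' : θ * z' = θ * z + θ * d := by rw [hdd]; ring
  have hD : 0 ≤ D := (abs_nonneg _).trans hd
  have hθd : |θ * d| ≤ θ * D := by
    rw [abs_mul, abs_of_nonneg hθ]; exact mul_le_mul_of_nonneg_left hd hθ
  have hθd2 : (θ * d) ^ 2 ≤ (θ * D) ^ 2 := by
    rw [← sq_abs]; exact pow_le_pow_left₀ (abs_nonneg _) hθd 2
  have hc := cosh_le_one_add_sq (hθd.trans hθD)
  have hs := sinh_le_add_sq (hθd.trans hθD)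
  have hC : 0 < Real.cosh (θ * z) := Real.cosh_pos _
  have hS : 0 ≤ Real.sinh (θ * z) := Real.sinh_nonneg_iff.2 (mul_nonneg hθ hz)
  have hSC : Real.sinh (θ * z) ≤ Real.cosh (θ * z) := (Real.sinh_lt_cosh _).le
  have h1 : Real.cosh (θ * z') ≤ Real.cosh (θ * z) * (1 + (θ * D) ^ 2)
      + Real.sinh (θ * z) * (θ * d + (θ * D) ^ 2) := by
    rw [hz', Real.cosh_add]
    gcongr
    · linarith
    · linarith
  have h2 : Real.sinh (θ * z) * (θ * D) ^ 2 ≤ Real.cosh (θ * z) * (θ * D) ^ 2 := by gcongr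
  have h3 : θ * (Real.sinh (θ * z) * d) ≤ Real.cosh (θ * z) * (1 / 2 * (θ * D) ^ 2)
      + θ * (Real.sinh (θ * z) / z) * m := by
    -- At `z = 0` the quotient `sinh (θ * z) / z` is `0` by the division convention.
    rcases hz.eq_or_lt with h0 | hpos
    · simp only [← h0, mul_zero, Real.sinh_zero, zero_mul, zero_div, Real.cosh_zero, add_zero]
      positivity
    · set w := Real.sinh (θ * z) / z with hw
      have hw0 : 0 ≤ w := by positivity
      have hwz : w * z = Real.sinh (θ * z) := by rw [hw]; field_simp
      have hwC : w ≤ θ * Real.cosh (θ * z) := by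
        rw [hw, div_le_iff₀ hpos]
        have := sinh_le_mul_cosh (mul_nonneg hθ hz)
        linarith
      have hzd : z * d ≤ m + D ^ 2 / 2 := by
        have : z' = z + d := by rw [hdd]; ring
        rw [this] at hsq
        nlinarith [sq_nonneg d]
      calc θ * (Real.sinh (θ * z) * d) = θ * w * (z * d) := by rw [← hwz]; ring
        _ ≤ θ * w * (m + D ^ 2 / 2) := by gcongr
        _ = θ * w * (D ^ 2 / 2) + θ * w * m := by ring
        _ ≤ θ * (θ * Real.cosh (θ * z)) * (D ^ 2 / 2) + θ * w * m := by gcongr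
        _ = _ := by ring
  -- The constant is `5 / 2 = 1 + 1 + 1 / 2`: the remainders of `cosh` and `sinh`, and the `D ^ 2 /
  -- 2` in the bound on `z * d`.
  nlinarith

/-- The Stirling sequence decreases, so it is at most its value `e / √2` at `1`. -/
theorem factorial_le_rpow_mul_exp {r : ℕ} (hr : 1 ≤ r) :
    (r.factorial : ℝ) ≤ (r : ℝ) ^ ((r : ℝ) + 1 / 2) * Real.exp (1 - (r : ℝ)) := by
  have hr0 : (0 : ℝ) < r := by exact_mod_cast hr
  have h := Stirling.stirlingSeq'_antitone (Nat.zero_le (r - 1))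
  simp only [Function.comp, Nat.succ_eq_add_one, Nat.sub_add_cancel hr, zero_add,
    Stirling.stirlingSeq_one] at h
  rw [Stirling.stirlingSeq, div_le_div_iff₀ (by positivity) (by positivity)] at h
  have he : Real.exp (r : ℝ) = Real.exp 1 ^ r := by rw [← Real.exp_nat_mul, mul_one]
  have h2 : (0 : ℝ) < √2 := by positivity
  rw [Real.rpow_add hr0, Real.rpow_natCast, ← Real.sqrt_eq_rpow, Real.exp_sub, he]
  rw [Real.sqrt_mul (by norm_num), div_pow] at h
  refine le_of_mul_le_mul_right (h.trans_eq ?_) h2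
  ring

/-! ### Geometry of the orthogonal component -/

variable {N : ℕ}

theorem toVec_apply (q : Fin N → ℕ) (n : Fin N) : toVec q n = q n := rfl

theorem inner_eq_sum (x y : Vec N) : inner ℝ x y = ∑ n, x n * y n := by
  simp [PiLp.inner_apply, mul_comm]

theorem perp_eq {c : Vec N} (hc : ‖c‖ = 1) (q : Fin N → ℕ) :
    perp c q = toVec q - (inner ℝ c (toVec q) : ℝ) • c := by
  rw [perp, Submodule.starProjection_unit_singleton ℝ hc]

theorem norm_sub_inner_smul_sq {c : Vec N} (hc : ‖c‖ = 1) (x : Vec N) :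
    ‖x - (inner ℝ c x : ℝ) • c‖ ^ 2 = ‖x‖ ^ 2 - (inner ℝ c x : ℝ) ^ 2 := by
  rw [norm_sub_sq_real, norm_smul, hc, inner_smul_right, real_inner_comm x c, mul_one,
    Real.norm_eq_abs, sq_abs]
  ring

theorem norm_perp_sq {c : Vec N} (hc : ‖c‖ = 1) (q : Fin N → ℕ) :
    ‖perp c q‖ ^ 2 = ‖toVec q‖ ^ 2 - (inner ℝ c (toVec q) : ℝ) ^ 2 := by
  rw [perp_eq hc, norm_sub_inner_smul_sq hc]

theorem inner_perp {c : Vec N} (hc : ‖c‖ = 1) (q : Fin N → ℕ) (x : Vec N) :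
    inner ℝ (perp c q) x
      = (inner ℝ (toVec q) x : ℝ) - inner ℝ c (toVec q) * inner ℝ c x := by
  rw [perp_eq hc, inner_sub_left, inner_smul_left]
  simp

theorem inner_self_perp {c : Vec N} (hc : ‖c‖ = 1) (q : Fin N → ℕ) :
    (inner ℝ c (perp c q) : ℝ) = 0 := by
  rw [real_inner_comm, inner_perp hc, real_inner_self_eq_norm_sq, hc, real_inner_comm c]
  ring

theorem abs_norm_perp_sub_le {c : Vec N} (hc : ‖c‖ = 1) (q q' : Fin N → ℕ) :
    |‖perp c q'‖ - ‖perp c q‖| ≤ ‖toVec q' - toVec q‖ := by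
  refine (abs_norm_sub_norm_le _ _).trans ?_
  have h : perp c q' - perp c q
      = (toVec q' - toVec q) - (inner ℝ c (toVec q' - toVec q) : ℝ) • c := by
    rw [perp_eq hc, perp_eq hc, inner_sub_right, sub_smul]
    abel
  rw [h]
  refine (sq_le_sq₀ (norm_nonneg _) (norm_nonneg _)).1 ?_
  rw [norm_sub_inner_smul_sq hc]
  linarith [sq_nonneg (inner ℝ c (toVec q' - toVec q) : ℝ)]

theorem nextQueue_eq_max (q a s : Fin N → ℕ) (n : Fin N) :
    (nextQueue q a s n : ℝ) = max ((q n : ℝ) + (a n - s n)) 0 := by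
  have h : (nextQueue q a s n : ℤ) = max ((q n : ℤ) + (a n - s n)) 0 := by
    rw [nextQueue_cast]; omega
  exact_mod_cast congrArg (Int.cast : ℤ → ℝ) h

theorem norm_sq_le_of_abs_le {x : Vec N} {B : ℝ} (h : ∀ n, |x n| ≤ B) :
    ‖x‖ ^ 2 ≤ N * B ^ 2 := by
  rw [EuclideanSpace.real_norm_sq_eq]
  calc ∑ n, x n ^ 2 ≤ ∑ _n : Fin N, B ^ 2 := by
        refine Finset.sum_le_sum fun n _ => ?_
        rw [← sq_abs]
        exact pow_le_pow_left₀ (abs_nonneg _) (h n) 2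
    _ = N * B ^ 2 := by simp

/-! ### One time slot of the queue dynamics -/

section Step

variable {q a s : Fin N → ℕ} {Amax Smax : ℝ}

theorem abs_sub_le_max (ha : ∀ n, (a n : ℝ) ≤ Amax) (hs : ∀ n, (s n : ℝ) ≤ Smax) (n : Fin N) :
    |(a n : ℝ) - s n| ≤ max Amax Smax := by
  have h1 : (0 : ℝ) ≤ a n := Nat.cast_nonneg _
  have h2 : (0 : ℝ) ≤ s n := Nat.cast_nonneg _
  have h3 := (ha n).trans (le_max_left Amax Smax)
  have h4 := (hs n).trans (le_max_right Amax Smax)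
  rw [abs_le]
  constructor <;> linarith

theorem norm_arrival_sub_service_sq_le (ha : ∀ n, (a n : ℝ) ≤ Amax)
    (hs : ∀ n, (s n : ℝ) ≤ Smax) :
    ‖toVec a - toVec s‖ ^ 2 ≤ constL N Amax Smax :=
  norm_sq_le_of_abs_le fun n => abs_sub_le_max ha hs n

theorem norm_nextQueue_sub_sq_le (ha : ∀ n, (a n : ℝ) ≤ Amax) (hs : ∀ n, (s n : ℝ) ≤ Smax) :
    ‖toVec (nextQueue q a s) - toVec q‖ ^ 2 ≤ constL N Amax Smax := by
  refine norm_sq_le_of_abs_le fun n => ?_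
  refine le_trans ?_ (abs_sub_le_max ha hs n)
  have hq : (0 : ℝ) ≤ q n := Nat.cast_nonneg _
  simp only [PiLp.sub_apply, toVec_apply, nextQueue_eq_max]
  have := abs_max_sub_max_le_abs ((q n : ℝ) + (a n - s n)) (q n : ℝ) 0
  rw [max_eq_left hq] at this
  simpa using this

theorem norm_nextQueue_sq_le :
    ‖toVec (nextQueue q a s)‖ ^ 2 ≤ ‖toVec q + (toVec a - toVec s)‖ ^ 2 := by
  rw [EuclideanSpace.real_norm_sq_eq, EuclideanSpace.real_norm_sq_eq]
  refine Finset.sum_le_sum fun n _ => ?_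
  simp only [PiLp.add_apply, PiLp.sub_apply, toVec_apply, nextQueue_eq_max]
  rcases le_total ((q n : ℝ) + (a n - s n)) 0 with h | h
  · rw [max_eq_right h]
    simpa using sq_nonneg ((q n : ℝ) + (a n - s n))
  · rw [max_eq_left h]

theorem inner_nextQueue_ge {c : Vec N} (hc0 : ∀ n, 0 ≤ c n) :
    (inner ℝ c (toVec q) : ℝ) + inner ℝ c (toVec a - toVec s)
      ≤ inner ℝ c (toVec (nextQueue q a s)) := by
  rw [← inner_add_right, inner_eq_sum, inner_eq_sum]
  refine Finset.sum_le_sum fun n _ => mul_le_mul_of_nonneg_left ?_ (hc0 n)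
  simp only [PiLp.add_apply, PiLp.sub_apply, toVec_apply, nextQueue_eq_max]
  exact le_max_left _ _

theorem inner_toVec_nonneg {c : Vec N} (hc0 : ∀ n, 0 ≤ c n) (q : Fin N → ℕ) :
    (0 : ℝ) ≤ inner ℝ c (toVec q) := by
  rw [inner_eq_sum]
  exact Finset.sum_nonneg fun n _ => mul_nonneg (hc0 n) (Nat.cast_nonneg _)

/-- Unused service only helps: truncation at `0` shrinks the norm and, as `c ≥ 0`, raises the
component along `c`. -/
theorem norm_perp_nextQueue_sq_le {c : Vec N} (hc : ‖c‖ = 1) (hc0 : ∀ n, 0 ≤ c n)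
    (ha : ∀ n, (a n : ℝ) ≤ Amax) (hs : ∀ n, (s n : ℝ) ≤ Smax) :
    ‖perp c (nextQueue q a s)‖ ^ 2 ≤ ‖perp c q‖ ^ 2
      + 2 * inner ℝ (perp c q) (toVec a - toVec s) + constL N Amax Smax := by
  rw [norm_perp_sq hc, norm_perp_sq hc, inner_perp hc]
  have h1 := norm_nextQueue_sq_le (q := q) (a := a) (s := s)
  rw [norm_add_sq_real] at h1
  have h2 := norm_arrival_sub_service_sq_le ha hs
  have h3 := inner_nextQueue_ge (q := q) (a := a) (s := s) hc0
  have h4 := inner_toVec_nonneg hc0 q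
  set x : ℝ := inner ℝ c (toVec q)
  set y : ℝ := inner ℝ c (toVec (nextQueue q a s))
  set z : ℝ := inner ℝ c (toVec a - toVec s)
  -- Uses `y ^ 2 ≥ x ^ 2 + 2 * x * (y - x) ≥ x ^ 2 + 2 * x * z`, the last by `x ≥ 0`.
  nlinarith [sq_nonneg (y - x), mul_nonneg h4 (sub_nonneg.2 h3)]

end Step

/-! ### MaxWeight against the capacity region -/

theorem inner_le_of_isMaxWeight {𝒮 : Set (Fin N → ℕ)} {σ : (Fin N → ℕ) → PMF (Fin N → ℕ)}
    (hσ : IsMaxWeight 𝒮 σ) {q s : Fin N → ℕ} (hs : s ∈ (σ q).support) {r : Vec N}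
    (hr : r ∈ capacityRegion 𝒮) : (inner ℝ (toVec q) r : ℝ) ≤ inner ℝ (toVec q) (toVec s) := by
  have hconv : Convex ℝ {x : Vec N | (inner ℝ (toVec q) x : ℝ) ≤ inner ℝ (toVec q) (toVec s)} :=
    convex_halfSpace_le (innerₗ (Vec N) (toVec q)).isLinear _
  refine convexHull_min ?_ hconv hr
  rintro _ ⟨s', hs', rfl⟩
  exact (hσ q s hs).2 s' hs'

/-- A MaxWeight service vector drains the orthogonal component at rate at least the radius of a
ball of the face around `lam`. -/
theorem inner_perp_service_ge {𝒮 : Set (Fin N → ℕ)} {σ : (Fin N → ℕ) → PMF (Fin N → ℕ)}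
    {c lam : Vec N} {b ρ : ℝ} (hc : ‖c‖ = 1) (hc0 : ∀ n, 0 ≤ c n) (hρ : 0 ≤ ρ)
    (hb : ∀ r ∈ capacityRegion 𝒮, (inner ℝ c r : ℝ) ≤ b) (hlam : (inner ℝ c lam : ℝ) = b)
    (hball : ∀ r : Vec N, (inner ℝ c r : ℝ) = b → dist r lam ≤ ρ → r ∈ capacityRegion 𝒮)
    (hσ : IsMaxWeight 𝒮 σ) {q s : Fin N → ℕ} (hs : s ∈ (σ q).support) :
    (inner ℝ (perp c q) lam : ℝ) + ρ * ‖perp c q‖ ≤ inner ℝ (perp c q) (toVec s) := by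
  set z := perp c q with hz
  -- The point of the ball farthest along `z`; it is `lam` itself when `z = 0`.
  set r : Vec N := lam + (ρ * ‖z‖⁻¹) • z with hr
  have hcr : (inner ℝ c r : ℝ) = b := by
    rw [hr, inner_add_right, inner_smul_right, inner_self_perp hc, hlam]; ring
  have hrR : r ∈ capacityRegion 𝒮 := by
    refine hball r hcr ?_
    rw [hr, dist_eq_norm, add_sub_cancel_left, norm_smul, norm_mul, norm_inv, norm_norm,
      Real.norm_of_nonneg hρ, mul_assoc]
    exact mul_le_of_le_one_right hρ inv_mul_le_one
  have h1 := inner_le_of_isMaxWeight hσ hs hrR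
  have h2 : (inner ℝ c (toVec s) : ℝ) ≤ b :=
    hb _ (subset_convexHull ℝ _ ⟨s, (hσ q s hs).1, rfl⟩)
  have h3 : (inner ℝ z r : ℝ) = inner ℝ z lam + ρ * ‖z‖ := by
    rw [hr, inner_add_right, inner_smul_right, real_inner_self_eq_norm_sq]
    rcases (norm_nonneg z).eq_or_lt with h | h
    · simp [← h]
    · field_simp
  rw [← h3, inner_perp hc, inner_perp hc, hcr]
  nlinarith [mul_nonneg (inner_toVec_nonneg hc0 q) (sub_nonneg.2 h2)]

/-! ### Facets and the relative interior -/

section Facet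

variable {K : ℕ} {𝒮 : Set (Fin N → ℕ)} {c : Fin K → Vec N} {b : Fin K → ℝ}

theorem pos_and_lt_of_mem_interior (h : IsHyperplaneDescription 𝒮 c b) {r : Vec N}
    (hr : r ∈ interior (capacityRegion 𝒮)) :
    (∀ n, 0 < r n) ∧ ∀ j, (inner ℝ (c j) r : ℝ) < b j := by
  have key : ∀ v : Vec N, ∃ t : ℝ, 0 < t ∧ r + t • v ∈ capacityRegion 𝒮 := by
    intro v
    have hcont : Continuous fun t : ℝ => r + t • v := by fun_prop
    have hmem : ∀ᶠ t : ℝ in nhds 0, r + t • v ∈ capacityRegion 𝒮 := by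
      refine hcont.continuousAt.eventually ?_
      simpa using mem_interior_iff_mem_nhds.1 hr
    obtain ⟨ε, hε, hball⟩ := Metric.eventually_nhds_iff.1 hmem
    refine ⟨ε / 2, by positivity, hball ?_⟩
    rw [Real.dist_eq, sub_zero, abs_of_pos (by positivity)]
    linarith
  constructor
  · intro n
    obtain ⟨t, ht, hm⟩ := key (-EuclideanSpace.single n 1)
    rw [h.region_eq] at hm
    have := hm.1 n
    simp at this
    linarith
  · intro j
    obtain ⟨t, ht, hm⟩ := key (c j)
    rw [h.region_eq] at hm
    have := hm.2 j
    rw [inner_add_right, inner_smul_right, real_inner_self_eq_norm_sq, h.unit j] at this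
    linarith

/-- An irredundant inequality of a full-dimensional region cuts out a facet: the affine span of
the face is the whole hyperplane. -/
theorem mem_affineSpan_face (h : IsHyperplaneDescription 𝒮 c b)
    (hint : (interior (capacityRegion 𝒮)).Nonempty) (k : Fin K) {x : Vec N}
    (hx : (inner ℝ (c k) x : ℝ) = b k) : x ∈ affineSpan ℝ (face 𝒮 (c k) (b k)) := by
  obtain ⟨r₀, hr₀⟩ := hint
  obtain ⟨hpos, hlt⟩ := pos_and_lt_of_mem_interior h hr₀
  obtain ⟨r, hr0, hri, hrk⟩ := h.irredundant k
  set u : ℝ := inner ℝ (c k) r₀ with hu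
  set v : ℝ := inner ℝ (c k) r with hv
  have huv : 0 < v - u := by linarith [hlt k]
  -- Chosen so that the segment from the interior point `r₀` to `r`, which violates only inequality
  -- `k`, meets the hyperplane at `p`.
  set t : ℝ := (b k - u) / (v - u) with ht
  have ht0 : 0 < t := div_pos (by linarith [hlt k]) huv
  have ht1 : t < 1 := by rw [ht, div_lt_one huv]; linarith
  set p : Vec N := (1 - t) • r₀ + t • r with hp
  have hpk : (inner ℝ (c k) p : ℝ) = b k := by
    rw [hp, inner_add_right, inner_smul_right, inner_smul_right, ← hu, ← hv]
    have : t * (v - u) = b k - u := by rw [ht]; field_simp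
    linarith
  -- All constraints but the `k`-th, made strict: an open set whose trace on the hyperplane lies in
  -- the face. Any `x` of the hyperplane is then on a line through `p` and a nearby point of the
  -- face.
  set G : Set (Vec N) := {y | (∀ n, 0 < y n) ∧ ∀ i, i ≠ k → (inner ℝ (c i) y : ℝ) < b i} with hG
  have hGopen : IsOpen G := by
    rw [hG, Set.ofPred_and]
    refine IsOpen.inter ?_ ?_
    · simp only [Set.ofPred_forall]
      exact isOpen_iInter_of_finite fun n => isOpen_lt continuous_const (by fun_prop)
    · simp only [Set.ofPred_forall]
      exact isOpen_iInter_of_finite fun i => isOpen_iInter_of_finite fun _ =>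
        isOpen_lt (by fun_prop) continuous_const
  have hpG : p ∈ G := by
    refine ⟨fun n => ?_, fun i hi => ?_⟩
    · simp only [hp, PiLp.add_apply, PiLp.smul_apply, smul_eq_mul]
      have := mul_pos (sub_pos.2 ht1) (hpos n)
      have := mul_nonneg ht0.le (hr0 n)
      linarith
    · rw [hp, inner_add_right, inner_smul_right, inner_smul_right]
      have := mul_lt_mul_of_pos_left (hlt i) (sub_pos.2 ht1)
      have := mul_le_mul_of_nonneg_left (hri i hi) ht0.le
      linarith
  have hface : ∀ y ∈ G, (inner ℝ (c k) y : ℝ) = b k → y ∈ face 𝒮 (c k) (b k) := by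
    intro y hy hyk
    refine ⟨?_, hyk⟩
    rw [h.region_eq]
    refine ⟨fun n => (hy.1 n).le, fun i => ?_⟩
    by_cases hi : i = k
    · subst hi; exact hyk.le
    · exact (hy.2 i hi).le
  have hcont : Continuous fun τ : ℝ => p + τ • (x - p) := by fun_prop
  have hev : ∀ᶠ τ : ℝ in nhds 0, p + τ • (x - p) ∈ G := by
    refine hcont.continuousAt.eventually ?_
    simpa using hGopen.mem_nhds hpG
  obtain ⟨ε, hε, hball⟩ := Metric.eventually_nhds_iff.1 hev
  have hτ : ε / 2 ≠ 0 := by positivity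
  have hyG : p + (ε / 2) • (x - p) ∈ G := hball (by
    rw [Real.dist_eq, sub_zero, abs_of_pos (by positivity)]; linarith)
  have hyk : (inner ℝ (c k) (p + (ε / 2) • (x - p)) : ℝ) = b k := by
    rw [inner_add_right, inner_smul_right, inner_sub_right, hx, hpk]; ring
  have hline : AffineMap.lineMap p (p + (ε / 2) • (x - p)) (ε / 2)⁻¹ = x := by
    rw [AffineMap.lineMap_apply_module', add_sub_cancel_left, smul_smul, inv_mul_cancel₀ hτ,
      one_smul, sub_add_cancel]
  rw [← hline]
  exact AffineMap.lineMap_mem _ (subset_affineSpan ℝ _ (hface p hpG hpk))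
    (subset_affineSpan ℝ _ (hface _ hyG hyk))

end Facet

theorem exists_closedBall_of_mem_intrinsicInterior {F : Set (Vec N)} {lam : Vec N}
    (h : lam ∈ intrinsicInterior ℝ F) :
    ∃ ρ : ℝ, 0 < ρ ∧ ∀ r ∈ affineSpan ℝ F, dist r lam ≤ ρ → r ∈ F := by
  obtain ⟨y, hy, rfl⟩ := mem_intrinsicInterior.1 h
  obtain ⟨ρ, hρ, hball⟩ := Metric.mem_nhds_iff.1 (mem_interior_iff_mem_nhds.1 hy)
  refine ⟨ρ / 2, by positivity, fun r hr hd => ?_⟩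
  have : (⟨r, hr⟩ : affineSpan ℝ F) ∈ Metric.ball y ρ := by
    rw [Metric.mem_ball, Subtype.dist_eq]
    exact lt_of_le_of_lt hd (by linarith)
  exact hball this

/-! ### Arrivals and the drift of the Lyapunov function -/

theorem expect_transition (α : PMF (Fin N → ℕ)) (σ : (Fin N → ℕ) → PMF (Fin N → ℕ))
    (q : Fin N → ℕ) (f : (Fin N → ℕ) → ℝ≥0∞) :
    expect (transition α σ q) f
      = expect α fun a => expect (σ q) fun s => f (nextQueue q a s) := by
  simp only [transition, expect_bind, expect_pure]

section Arrival

variable {α : PMF (Fin N → ℕ)} {Amax : ℝ} {m : Vec N}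

theorem IsArrivalLaw.integrable_coord (h : IsArrivalLaw α Amax m) (n : Fin N) :
    Integrable (fun a : Fin N → ℕ => (a n : ℝ)) α.toMeasure := by
  refine Integrable.of_bound (C := Amax) (Measurable.of_discrete).aestronglyMeasurable ?_
  refine ae_toMeasure_iff fun a ha => ?_
  rw [Real.norm_of_nonneg (Nat.cast_nonneg _)]
  exact h.bounded a ha n

theorem IsArrivalLaw.integrable_inner (h : IsArrivalLaw α Amax m) (v : Vec N) :
    Integrable (fun a => (inner ℝ v (toVec a) : ℝ)) α.toMeasure := by
  simp only [inner_eq_sum, toVec_apply]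
  exact integrable_finsetSum _ fun n _ => (h.integrable_coord n).const_mul _

theorem IsArrivalLaw.integral_inner (h : IsArrivalLaw α Amax m) (v : Vec N) :
    ∫ a, (inner ℝ v (toVec a) : ℝ) ∂α.toMeasure = inner ℝ v m := by
  simp only [inner_eq_sum, toVec_apply]
  rw [integral_finsetSum _ fun n _ => (h.integrable_coord n).const_mul _]
  exact Finset.sum_congr rfl fun n _ => by rw [integral_const_mul, h.mean]

end Arrival

/-- The geometric drift of `cosh (θ ‖Q_⊥‖)` under MaxWeight. -/
theorem expect_cosh_drift {𝒮 : Set (Fin N → ℕ)} {α : PMF (Fin N → ℕ)}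
    {σ : (Fin N → ℕ) → PMF (Fin N → ℕ)} {c lam : Vec N} {b ρ ε Amax Smax D θ : ℝ}
    (hc : ‖c‖ = 1) (hc0 : ∀ n, 0 ≤ c n) (hρ : 0 ≤ ρ)
    (hb : ∀ r ∈ capacityRegion 𝒮, (inner ℝ c r : ℝ) ≤ b) (hlam : (inner ℝ c lam : ℝ) = b)
    (hball : ∀ r : Vec N, (inner ℝ c r : ℝ) = b → dist r lam ≤ ρ → r ∈ capacityRegion 𝒮)
    (hS : ∀ s ∈ 𝒮, ∀ n, (s n : ℝ) ≤ Smax)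
    (hα : IsArrivalLaw α Amax (lam - ε • c)) (hσ : IsMaxWeight 𝒮 σ)
    (hD : 0 ≤ D) (hDL : constL N Amax Smax = D ^ 2) (hθ : 0 ≤ θ) (hθD : θ * D ≤ 1)
    (hθρ : 5 * (θ * D ^ 2) ≤ ρ) (q : Fin N → ℕ) :
    expect (transition α σ q) (fun x => ENNReal.ofReal (Real.cosh (θ * ‖perp c x‖)))
        + ENNReal.ofReal (θ * ρ / 2 * Real.cosh (θ * ‖perp c q‖))
      ≤ ENNReal.ofReal (Real.cosh (θ * ‖perp c q‖)) + ENNReal.ofReal (θ * ρ) := by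
  set Z := ‖perp c q‖ with hZ
  have hZ0 : 0 ≤ Z := norm_nonneg _
  set C := Real.cosh (θ * Z) with hC
  have hC0 : 0 < C := Real.cosh_pos _
  set w := Real.sinh (θ * Z) / Z with hw
  have hw0 : 0 ≤ w := div_nonneg (Real.sinh_nonneg_iff.2 (mul_nonneg hθ hZ0)) hZ0
  have hwZ : w * Z = Real.sinh (θ * Z) := by
    rcases hZ0.eq_or_lt with h | h
    · simp [← h]
    · rw [hw]; field_simp
  -- A bound affine in the arrivals and free of the service vector, so only the arrival mean enters
  -- its expectation.
  set B : (Fin N → ℕ) → ℝ := fun a =>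
    (C * (1 + 5 / 2 * (θ * D) ^ 2) - θ * ρ * Real.sinh (θ * Z))
      + θ * w * (inner ℝ (perp c q) (toVec a) - inner ℝ (perp c q) lam) with hB
  have hstep : ∀ a ∈ α.support, ∀ s ∈ (σ q).support,
      Real.cosh (θ * ‖perp c (nextQueue q a s)‖) ≤ B a := by
    intro a ha s hs
    have ha' := hα.bounded a ha
    have hs' := hS s (hσ q s hs).1
    have hd : |‖perp c (nextQueue q a s)‖ - ‖perp c q‖| ≤ D := by
      refine (abs_norm_perp_sub_le hc _ _).trans ((sq_le_sq₀ (norm_nonneg _) hD).1 ?_)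
      rw [← hDL]
      exact norm_nextQueue_sub_sq_le ha' hs'
    have hsq := norm_perp_nextQueue_sq_le (q := q) hc hc0 ha' hs'
    rw [hDL] at hsq
    refine (cosh_step hθ hθD hZ0 hd hsq).trans ?_
    have hserv := inner_perp_service_ge hc hc0 hρ hb hlam hball hσ hs
    rw [← hZ] at hserv
    rw [← hC, ← hw, inner_sub_right]
    have h1 : θ * w * (inner ℝ (perp c q) lam + ρ * Z)
        ≤ θ * w * inner ℝ (perp c q) (toVec s) := by gcongr
    simp only [hB]
    rw [← hwZ]
    linarith
  have hAint : Integrable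
      (fun a => θ * w * (inner ℝ (perp c q) (toVec a) - inner ℝ (perp c q) lam : ℝ))
      α.toMeasure := ((hα.integrable_inner _).sub (integrable_const _)).const_mul _
  have hBint : Integrable B α.toMeasure :=
    (integrable_const _).add hAint
  have hBmean : ∫ a, B a ∂α.toMeasure
      = C * (1 + 5 / 2 * (θ * D) ^ 2) - θ * ρ * Real.sinh (θ * Z) := by
    have h0 : (inner ℝ (perp c q) (lam - ε • c) : ℝ) = inner ℝ (perp c q) lam := by
      rw [inner_sub_right, inner_smul_right, real_inner_comm c, inner_self_perp hc]
      ring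
    simp only [hB]
    rw [integral_add (integrable_const _) hAint, integral_const_mul,
      integral_sub (hα.integrable_inner _) (integrable_const _), hα.integral_inner, h0]
    simp
  have hB0 : ∀ a ∈ α.support, 0 ≤ B a := by
    intro a ha
    obtain ⟨s, hs⟩ := (σ q).support_nonempty
    exact (Real.cosh_pos _).le.trans (hstep a ha s hs)
  have hE : expect (transition α σ q) (fun x => ENNReal.ofReal (Real.cosh (θ * ‖perp c x‖)))
      ≤ ENNReal.ofReal (∫ a, B a ∂α.toMeasure) := by
    rw [expect_transition, ofReal_integral_eq_lintegral_ofReal hBint (ae_toMeasure_iff hB0),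
      lintegral_toMeasure]
    refine expect_mono fun a ha => ?_
    rw [← expect_const (σ q) (ENNReal.ofReal (B a))]
    exact expect_mono fun s hs => ENNReal.ofReal_le_ofReal (hstep a ha s hs)
  have hmean0 : 0 ≤ ∫ a, B a ∂α.toMeasure := integral_nonneg_of_ae (ae_toMeasure_iff hB0)
  refine (add_le_add_left hE _).trans ?_
  rw [← ENNReal.ofReal_add hmean0 (by positivity), ← ENNReal.ofReal_add hC0.le (by positivity)]
  refine ENNReal.ofReal_le_ofReal ?_
  rw [hBmean]
  -- Trades `sinh` for `cosh`; half of the gain `θ * ρ * C` then absorbs the quadratic error, by `5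
  -- * (θ * D ^ 2) ≤ ρ`.
  have hsinh : C - 1 ≤ Real.sinh (θ * Z) := by
    have h1 := Real.cosh_sub_sinh (θ * Z)
    have h2 : Real.exp (-(θ * Z)) ≤ 1 := Real.exp_le_one_iff.2 (by
      have := mul_nonneg hθ hZ0
      linarith)
    linarith
  have h1 : θ * ρ * (C - 1) ≤ θ * ρ * Real.sinh (θ * Z) := by gcongr
  have h2 : C * θ / 2 * (5 * (θ * D ^ 2)) ≤ C * θ / 2 * ρ := by gcongr
  nlinarith

/-! ### Moments from the exponential bound -/

/-- One term of the exponential series, together with `exp ≤ 2 * cosh`. -/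
theorem pow_le_cosh {θ z : ℝ} (hθ : 0 < θ) (hz : 0 ≤ z) (r : ℕ) :
    z ^ r ≤ r.factorial * (2 / θ ^ r) * Real.cosh (θ * z) := by
  have h1 := Real.pow_div_factorial_le_exp (x := θ * z) (by positivity) r
  have h2 : Real.exp (θ * z) ≤ 2 * Real.cosh (θ * z) := by
    rw [Real.cosh_eq]
    linarith [Real.exp_pos (-(θ * z))]
  have h3 : (θ * z) ^ r ≤ 2 * Real.cosh (θ * z) * r.factorial := by
    have := h1.trans h2
    rwa [div_le_iff₀ (by positivity)] at this
  rw [mul_pow] at h3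
  have : z ^ r ≤ (2 * Real.cosh (θ * z) * r.factorial) / θ ^ r := by
    rw [le_div_iff₀ (by positivity)]
    linarith
  exact this.trans_eq (by ring)

theorem moment_le_of_expect_cosh {X : Type*} [Countable X] [MeasurableSpace X]
    [MeasurableSingletonClass X] {π : PMF X} {Z : X → ℝ} (hZ : ∀ x, 0 ≤ Z x) {θ : ℝ}
    (hθ : 0 < θ) (h : expect π (fun x => ENNReal.ofReal (Real.cosh (θ * Z x))) ≤ 2)
    {r : ℕ} (hr : 1 ≤ r) :
    Integrable (fun x => Z x ^ r) π.toMeasure ∧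
      ∫ x, Z x ^ r ∂π.toMeasure ≤ (4 / θ) ^ r * r.factorial := by
  have hpos : ∀ x, 0 ≤ Real.cosh (θ * Z x) := fun x => (Real.cosh_pos _).le
  rw [← lintegral_toMeasure] at h
  have hmeas : ∀ f : X → ℝ, AEStronglyMeasurable f π.toMeasure := fun f =>
    (Measurable.of_discrete).aestronglyMeasurable
  have hint : Integrable (fun x => Real.cosh (θ * Z x)) π.toMeasure := by
    refine ⟨hmeas _, ?_⟩
    rw [hasFiniteIntegral_iff_ofReal (Filter.Eventually.of_forall hpos)]
    exact lt_of_le_of_lt h (by simp)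
  have hle : ∫ x, Real.cosh (θ * Z x) ∂π.toMeasure ≤ 2 := by
    rw [integral_eq_lintegral_of_nonneg_ae (Filter.Eventually.of_forall hpos) (hmeas _)]
    exact ENNReal.toReal_le_of_le_ofReal (by norm_num) (by simpa using h)
  have hint' : Integrable (fun x => r.factorial * (2 / θ ^ r) * Real.cosh (θ * Z x))
      π.toMeasure := hint.const_mul _
  have hintZ : Integrable (fun x => Z x ^ r) π.toMeasure := by
    refine hint'.mono' (hmeas _) (Filter.Eventually.of_forall fun x => ?_)
    rw [Real.norm_of_nonneg (pow_nonneg (hZ x) r)]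
    exact pow_le_cosh hθ (hZ x) r
  refine ⟨hintZ, ?_⟩
  calc ∫ x, Z x ^ r ∂π.toMeasure
      ≤ ∫ x, r.factorial * (2 / θ ^ r) * Real.cosh (θ * Z x) ∂π.toMeasure :=
        integral_mono hintZ hint' fun x => pow_le_cosh hθ (hZ x) r
    _ = r.factorial * (2 / θ ^ r) * ∫ x, Real.cosh (θ * Z x) ∂π.toMeasure :=
        integral_const_mul _ _
    _ ≤ r.factorial * (2 / θ ^ r) * 2 := by gcongr
    _ = 4 / θ ^ r * r.factorial := by ring
    -- Only here is `r ≥ 1` needed.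
    _ ≤ 4 ^ r / θ ^ r * r.factorial := by
        gcongr
        exact le_self_pow₀ (by norm_num) (by omega)
    _ = _ := by rw [div_pow]

/-- Ensures `D > 0`, hence `θ > 0` in the main proof: interior points have positive coordinates, and
the bound by `Smax` passes to the convex hull. -/
theorem exists_pos_of_interior_nonempty (hN : 1 ≤ N) {𝒮 : Set (Fin N → ℕ)} {K : ℕ}
    {c : Fin K → Vec N} {b : Fin K → ℝ} (h : IsHyperplaneDescription 𝒮 c b)
    (hint : (interior (capacityRegion 𝒮)).Nonempty) {Smax : ℝ}
    (hS : ∀ s ∈ 𝒮, ∀ n, (s n : ℝ) ≤ Smax) : 0 < Smax := by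
  obtain ⟨r, hr⟩ := hint
  let n : Fin N := ⟨0, hN⟩
  have hpos := (pos_and_lt_of_mem_interior h hr).1 n
  have hle : capacityRegion 𝒮 ⊆ {x : Vec N | x n ≤ Smax} := by
    refine convexHull_min ?_ (convex_halfSpace_le
      (EuclideanSpace.proj n : Vec N →L[ℝ] ℝ).toLinearMap.isLinear _)
    rintro _ ⟨s, hs, rfl⟩
    exact hS s hs n
  exact hpos.trans_le (hle (interior_subset hr))

end MaxWeightSSC

/-! ### Choice of constants and conclusion -/

theorem proposition1 (N : ℕ) (hN : 1 ≤ N) (F : Set (MaxWeightSSC.Vec N))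
    (lam : MaxWeightSSC.Vec N) (hlam : lam ∈ intrinsicInterior ℝ F) :
    ∃ δ : ℝ, 0 < δ ∧
      ∀ (𝒮 : Set (Fin N → ℕ)) (K : ℕ) (c : Fin K → MaxWeightSSC.Vec N) (b : Fin K → ℝ)
        (k : Fin K) (Amax Smax : ℝ),
        (∀ s ∈ 𝒮, ∀ n, (s n : ℝ) ≤ Smax) →
        (interior (MaxWeightSSC.capacityRegion 𝒮)).Nonempty →
        MaxWeightSSC.IsHyperplaneDescription 𝒮 c b →
        (∀ n, 0 ≤ c k n) →
        F = MaxWeightSSC.face 𝒮 (c k) (b k) →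
        ∃ M : ℕ → ℝ,
          (∀ r : ℕ, 1 ≤ r →
            M r ≤ MaxWeightSSC.constV N Amax Smax δ r * (r : ℝ) ^ ((r : ℝ) + 1 / 2)
              * Real.exp (1 - (r : ℝ))) ∧
          ∀ ε : ℝ, 0 < ε →
            ∀ (α : PMF (Fin N → ℕ)) (σ : (Fin N → ℕ) → PMF (Fin N → ℕ))
              (π : PMF (Fin N → ℕ)),
              MaxWeightSSC.IsArrivalLaw α Amax (lam - ε • c k) →
              MaxWeightSSC.IsMaxWeight 𝒮 σ →
              MaxWeightSSC.IsSteadyState α σ π →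
              ∀ r : ℕ, 1 ≤ r →
                MeasureTheory.Integrable (fun q => ‖MaxWeightSSC.perp (c k) q‖ ^ r)
                    π.toMeasure ∧
                  ∫ q, ‖MaxWeightSSC.perp (c k) q‖ ^ r ∂π.toMeasure ≤ M r := by
  open MaxWeightSSC in
  obtain ⟨ρ, hρ, hball⟩ := exists_closedBall_of_mem_intrinsicInterior hlam
  refine ⟨ρ / 2, by positivity, ?_⟩
  intro 𝒮 K c b k Amax Smax hS hint hdesc hc0 hF
  have hlamF := intrinsicInterior_subset hlam
  set D := constD N Amax Smax with hD
  have hSpos := exists_pos_of_interior_nonempty hN hdesc hint hS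
  have hN0 : (0 : ℝ) < N := by exact_mod_cast hN
  have hDpos : 0 < D := mul_pos (Real.sqrt_pos.2 hN0) (lt_max_of_lt_right hSpos)
  have hDL : constL N Amax Smax = D ^ 2 := by
    rw [hD, constD, constL, mul_pow, Real.sq_sqrt hN0.le]
  set δ := ρ / 2 with hδ
  have hδ0 : 0 < δ := by positivity
  -- Since `L = D ^ 2`, this makes `4 / θ` exactly the base of `constV`. It also gives `θ * D ≤ 1`
  -- and, as `δ = ρ / 2`, `6 * (θ * D ^ 2) ≤ ρ`, a little more than the drift requires.
  set θ : ℝ := (3 * D ^ 2 / δ + D)⁻¹ with hθ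
  have hden : 0 < 3 * D ^ 2 / δ + D := by positivity
  have hθ0 : 0 < θ := inv_pos.2 hden
  have hV : ∀ r, constV N Amax Smax δ r = (4 / θ) ^ r := by
    intro r
    rw [constV, hDL, ← hD, hθ, div_inv_eq_mul]
    congr 1
    field_simp
    ring
  refine ⟨fun r => (4 / θ) ^ r * r.factorial, fun r hr => ?_, ?_⟩
  · rw [hV, mul_assoc]
    exact mul_le_mul_of_nonneg_left (factorial_le_rpow_mul_exp hr) (by positivity)
  intro ε _ α σ π hα hσ hπ r hr
  have hb : ∀ x ∈ capacityRegion 𝒮, (inner ℝ (c k) x : ℝ) ≤ b k := by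
    intro x hx
    rw [hdesc.region_eq] at hx
    exact hx.2 k
  have hball' : ∀ x : Vec N, (inner ℝ (c k) x : ℝ) = b k → dist x lam ≤ ρ →
      x ∈ capacityRegion 𝒮 := by
    intro x hx hd
    have hxF : x ∈ F := hball x (hF ▸ mem_affineSpan_face hdesc hint k hx) hd
    rw [hF] at hxF
    exact hxF.1
  have hlamb : (inner ℝ (c k) lam : ℝ) = b k := by
    rw [hF] at hlamF
    exact hlamF.2
  have hθD : θ * D ≤ 1 := by
    rw [hθ, inv_mul_le_iff₀ hden, mul_one]
    have : 0 < 3 * D ^ 2 / δ := by positivity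
    linarith
  have hθρ : 5 * (θ * D ^ 2) ≤ ρ := by
    have h1 : θ * (3 * D ^ 2 / δ) ≤ 1 := by
      rw [hθ, inv_mul_le_iff₀ hden, mul_one]
      linarith
    have h2 : θ * (3 * D ^ 2 / δ) = 3 * (θ * D ^ 2) / δ := by ring
    rw [h2, div_le_one hδ0] at h1
    linarith
  have hdrift := fun q => expect_cosh_drift (hdesc.unit k) hc0 hρ.le hb hlamb hball' hS hα hσ
    hDpos.le hDL hθ0.le hθD hθρ q
  have hE := expect_le_of_drift hπ (fun _ => ENNReal.ofReal_ne_top) hdrift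
  have hκ : 0 < θ * ρ / 2 := by positivity
  simp only [ENNReal.ofReal_mul hκ.le, expect_const_mul, expect_const] at hE
  have hθρ2 : ENNReal.ofReal (θ * ρ) = ENNReal.ofReal (θ * ρ / 2) * 2 := by
    rw [show (2 : ENNReal) = ENNReal.ofReal 2 by simp, ← ENNReal.ofReal_mul hκ.le]
    congr 1
    ring
  rw [hθρ2, ENNReal.mul_le_mul_iff_right (ENNReal.ofReal_pos.2 hκ).ne' ENNReal.ofReal_ne_top] at hE
  exact moment_le_of_expect_cosh (fun _ => norm_nonneg _) hθ0 hE hr
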